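/- Let $N=\{1,\dots,n\}$. A Nash–Stackelberg–Nash game under decision-dependent uncertainties consists of: strategy spaces $X_i\subseteq\mathbb R^{d_i}$ of the leaders $i\in N$, a strategy space $Y\subseteq\mathbb R^{p}$ of the followers, and a set $W\subseteq\mathbb R^{q}$ of possible realizations of the uncertainty; set-valued maps, all with non-empty values, $\mathcal X_i:X_{-i}\rightrightarrows X_i$ (feasible strategies of leader $i$), $\mathcal W:X\rightrightarrows W$ (decision-dependent uncertainty set) and $\mathcal G:X\times W\rightrightarrows Y$ (reaction map of the followers); and payoffs $f_i:X\times Y\times W\to\mathbb R$, $i\in N$. Here $X=\prod_{i\in N}X_i$, $X_{-i}=\prod_{j\ne i}X_j$, $x_{-i}$ is $x$ without its $i$-th component, and $f=(f_1,\dots,f_n)$. A point $(x^*,w^*,\mathbf y^*)$ with $x^*\in X$, $w^*\in W$ and $\mathbf y^*=(y^{[1]*},\dots,y^{[n]*},y^{[w]*})$, all of whose components lie in $\mathcal G(x^*,w^*)$, is a *weak equilibrium* if - $x_i^*\in\mathcal X_i(x_{-i}^*)$ for all $i\in N$, and $w^*\in\mathcal W(x^*)$; - for all $i\in N$, $f_i(x^*,y^{[i]*},w^*)\ge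 f_i((x_i,x^*_{-i}),y,w^*)$ for all $x_i\in\mathcal X_i(x^*_{-i})$ and $y\in\mathcal G((x_i,x^*_{-i}),w^*)$; - $f(x^*,y^{[w]*},w^*)-f(x^*,y,w)\notin\operatorname{int}\mathbb R^n_+$ for all $w\in\mathcal W(x^*)$ and $y\in\mathcal G(x^*,w)$. It is a *strong equilibrium* if the same holds with $\mathbb R^n_+\setminus\{0\}$ in place of $\operatorname{int}\mathbb R^n_+$. **Theorem.** Let the sets $X_i$ ($i\in N$), $Y$ and $W$ be non-empty, compact and convex. Assume that - every $\mathcal X_i$ and $\mathcal W$ are continuous (upper and lower semi-continuous) with compact convex values, and $\mathcal G$ is continuous with compact values and convex graph; - for every $i\in N$, $f_i$ is continuous on $X\times Y\times W$ and, for all $x_{-i}\in X_{-i}$ and $w\in W$, the function $(x_i,y)\mapsto f_i((x_i,x_{-i}),y,w)$ is quasi-concave on $X_i\times Y$. (a) If there is a non-empty $S\subseteq N$ such that for all $i\in S$ and $x\in X$ the function $(y,w)\mapsto -f_i(x,y,w)$ is concave on $Y\times W$, then the game has at least one weak equilibrium. (b) If this holds with $S=N$ (where $N\neq\emptyset$),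 then the game has at least one strong equilibrium. -/

import Mathlib

/-- The Euclidean space `ℝ^k`. -/
abbrev Eucl (k : ℕ) : Type := EuclideanSpace ℝ (Fin k)

/-- Strategy profiles `x = (x_1, …, x_n)` of the leaders, with `x_i ∈ ℝ^(d i)`. -/
abbrev Profile {n : ℕ} (d : Fin n → ℕ) : Type := ∀ i : Fin n, Eucl (d i)

/-- Profiles `x_{-i}` of the strategies of all the leaders other than `i`. -/
abbrev RivalProfile {n : ℕ} (d : Fin n → ℕ) (i : Fin n) : Type :=
  ∀ j : {j : Fin n // j ≠ i}, Eucl (d j)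

/-- The part `x_{-i}` of a profile `x`. -/
def rivals {n : ℕ} {d : Fin n → ℕ} (i : Fin n) (x : Profile d) : RivalProfile d i :=
  fun j => x j

/-- `F : A ⇉ B`: for every `a ∈ A`, `F a` is a non-empty subset of `B`. -/
def IsSetValuedMap {α β : Type*} (F : α → Set β) (A : Set α) (B : Set β) : Prop :=
  ∀ a ∈ A, (F a).Nonempty ∧ F a ⊆ B

/-- Continuity of a set-valued map on `A`: upper and lower semi-continuity at each point of `A`,
relatively to `A`. -/
def ContinuousSetValuedOn {α β : Type*} [TopologicalSpace α] [TopologicalSpace β]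
    (F : α → Set β) (A : Set α) : Prop :=
  UpperHemicontinuousOn F A ∧ LowerHemicontinuousOn F A

/-- A Nash-Stackelberg-Nash game under decision-dependent uncertainties with `n` leaders whose
strategies lie in `ℝ^(d 1), …, ℝ^(d n)`, the collective strategy of the followers in `ℝ^p` and
the uncertain factor in `ℝ^q`. Maps are given on the ambient spaces; only their values on the
strategy spaces are ever used. -/
structure NSNGame (n : ℕ) (d : Fin n → ℕ) (p q : ℕ) where
  /-- strategy space `X_i` of leader `i` -/
  X : ∀ i : Fin n, Set (Eucl (d i))
  /-- feasible strategy set `𝒳_i(x_{-i})` of leader `i` -/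
  feas : ∀ i : Fin n, RivalProfile d i → Set (Eucl (d i))
  /-- strategy space of the followers -/
  Y : Set (Eucl p)
  /-- set of all possible realizations of the uncertain factor -/
  W : Set (Eucl q)
  /-- decision-dependent uncertainty set `𝒲(x)` -/
  unc : Profile d → Set (Eucl q)
  /-- payoff `f_i(x, y, w)` of leader `i` -/
  f : Fin n → Profile d → Eucl p → Eucl q → ℝ
  /-- reaction map `𝒢(x, w)` of the followers -/
  G : Profile d → Eucl q → Set (Eucl p)
  feas_map : ∀ i, IsSetValuedMap (feas i) {z | ∀ j : {j : Fin n // j ≠ i}, z j ∈ X j} (X i)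
  unc_map : IsSetValuedMap unc {x | ∀ i, x i ∈ X i} W
  G_map : IsSetValuedMap (fun z : Profile d × Eucl q => G z.1 z.2)
    ({x | ∀ i, x i ∈ X i} ×ˢ W) Y

namespace NSNGame

variable {n : ℕ} {d : Fin n → ℕ} {p q : ℕ}

/-- The product `X = X_1 × … × X_n`. -/
def XProd (Θ : NSNGame n d p q) : Set (Profile d) := {x | ∀ i, x i ∈ Θ.X i}

/-- The product `X_{-i}` of the strategy spaces of the leaders other than `i`. -/
def XRivals (Θ : NSNGame n d p q) (i : Fin n) : Set (RivalProfile d i) :=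
  {z | ∀ j : {j : Fin n // j ≠ i}, z j ∈ Θ.X j}

/-- The vector `f(x, y, w) ∈ ℝ^n` of the payoffs of all leaders. -/
def payoff (Θ : NSNGame n d p q) (x : Profile d) (y : Eucl p) (w : Eucl q) : Fin n → ℝ :=
  fun i => Θ.f i x y w

/-- The graph of the reaction map `𝒢 : X × W ⇉ Y`. -/
def graphG (Θ : NSNGame n d p q) : Set ((Profile d × Eucl q) × Eucl p) :=
  {z | z.1 ∈ Θ.XProd ×ˢ Θ.W ∧ z.2 ∈ Θ.Y ∧ z.2 ∈ Θ.G z.1.1 z.1.2}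

/-- The assumptions on the set-valued maps of the game. -/
structure MapAssumption (Θ : NSNGame n d p q) : Prop where
  feas_continuous : ∀ i, ContinuousSetValuedOn (Θ.feas i) (Θ.XRivals i)
  feas_compact : ∀ i, ∀ z ∈ Θ.XRivals i, IsCompact (Θ.feas i z)
  feas_convex : ∀ i, ∀ z ∈ Θ.XRivals i, Convex ℝ (Θ.feas i z)
  G_continuous :
    ContinuousSetValuedOn (fun z : Profile d × Eucl q => Θ.G z.1 z.2) (Θ.XProd ×ˢ Θ.W)
  G_convex : Convex ℝ Θ.graphG
  G_compact : ∀ x ∈ Θ.XProd, ∀ w ∈ Θ.W, IsCompact (Θ.G x w)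
  unc_continuous : ContinuousSetValuedOn Θ.unc Θ.XProd
  unc_compact : ∀ x ∈ Θ.XProd, IsCompact (Θ.unc x)
  unc_convex : ∀ x ∈ Θ.XProd, Convex ℝ (Θ.unc x)

/-- The assumptions on the payoffs, relative to a set `S` of leaders. The profile
`Function.update x i u` is `(u, x_{-i})`. -/
structure PayoffAssumption (Θ : NSNGame n d p q) (S : Set (Fin n)) : Prop where
  quasiconcave : ∀ i, ∀ x ∈ Θ.XProd, ∀ w ∈ Θ.W,
    QuasiconcaveOn ℝ (Θ.X i ×ˢ Θ.Y)
      (fun z : Eucl (d i) × Eucl p => Θ.f i (Function.update x i z.1) z.2 w)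
  nonempty : S.Nonempty
  neg_concave : ∀ i ∈ S, ∀ x ∈ Θ.XProd,
    ConcaveOn ℝ (Θ.Y ×ˢ Θ.W) (fun z : Eucl p × Eucl q => - Θ.f i x z.1 z.2)
  continuous : ∀ i, ContinuousOn
    (fun z : Profile d × Eucl p × Eucl q => Θ.f i z.1 z.2.1 z.2.2) (Θ.XProd ×ˢ Θ.Y ×ˢ Θ.W)

/-- The conditions shared by weak and strong equilibria: feasibility of `x` and `w`, and, with
the anticipation `y i ∈ 𝒢(x, w)` of leader `i` on the followers' reaction, no leader can profit
from deviating unilaterally. -/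
structure LeaderConditions (Θ : NSNGame n d p q) (x : Profile d) (w : Eucl q)
    (y : Fin n → Eucl p) : Prop where
  x_mem : x ∈ Θ.XProd
  w_mem : w ∈ Θ.W
  feasible : ∀ i, x i ∈ Θ.feas i (rivals i x)
  realizable : w ∈ Θ.unc x
  anticipation : ∀ i, y i ∈ Θ.G x w
  optimal : ∀ i, ∀ u ∈ Θ.feas i (rivals i x), ∀ v ∈ Θ.G (Function.update x i u) w,
    Θ.f i (Function.update x i u) v w ≤ Θ.f i x (y i) w

/-- `(x, w, (y 1, …, y n, yw))` is a weak equilibrium point. -/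
structure IsWeakEquilibrium (Θ : NSNGame n d p q) (x : Profile d) (w : Eucl q)
    (y : Fin n → Eucl p) (yw : Eucl p) : Prop extends Θ.LeaderConditions x w y where
  yw_mem : yw ∈ Θ.G x w
  weak_pareto : ∀ t ∈ Θ.unc x, ∀ v ∈ Θ.G x t,
    Θ.payoff x yw w - Θ.payoff x v t ∉ interior (Set.Ici (0 : Fin n → ℝ))

/-- `(x, w, (y 1, …, y n, yw))` is a strong equilibrium point. -/
structure IsStrongEquilibrium (Θ : NSNGame n d p q) (x : Profile d) (w : Eucl q)
    (y : Fin n → Eucl p) (yw : Eucl p) : Prop extends Θ.LeaderConditions x w y where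
  yw_mem : yw ∈ Θ.G x w
  pareto : ∀ t ∈ Θ.unc x, ∀ v ∈ Θ.G x t,
    Θ.payoff x yw w - Θ.payoff x v t ∉ Set.Ici (0 : Fin n → ℝ) \ {0}

end NSNGame

/-!
An equilibrium is a fixed point of a product of best-response maps on the compact convex set
`X × W`. Given `(x, w)`, leader `i` answers with the strategies `u ∈ 𝒳_i(x_{-i})` for which some
reaction `v ∈ 𝒢((u, x_{-i}), w)` makes `f_i((u, x_{-i}), v, w)` maximal, and an uncertainty player
answers with the `t ∈ 𝒲(x)` for which some `v ∈ 𝒢(x, t)` makes a scalar cost `g(x, v, t)` minimal.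
The cost is `f_i` for a single `i ∈ S` in the weak case, and the sum of all the `f_i` in the strong
case: a minimizer of one payoff is weakly Pareto optimal, a minimizer of the sum is Pareto optimal.

These maps have convex values, because the graph of `𝒢` is convex and the objectives are
quasi-concave (`convex_bestResponses`), and compact graphs by Berge's maximum theorem
(`isCompact_graph_argmax`, `isCompact_graph_bestResponses`). Kakutani's theorem
(`exists_fixedPoint_of_isCompact_graph`) then gives the fixed point, and the reactions which support
it are the anticipations of the players.

Kakutani's theorem is derived from Brouwer's by gluing separating functionals with a partition of
unity. Brouwer's theorem follows from the `C¹` no-retraction theorem, which is proved by the volume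
argument of Milnor and Rogers: if `r` retracts the ball onto the sphere, the integral over the ball
of `det (1 + t (r' - 1))` is a polynomial in `t` which equals the volume of the ball for small
`t ≥ 0` and vanishes for `t = 1`.
-/

/-! ### Nearest-point projection and the no-retraction theorem -/

section Brouwer

open Set Metric MeasureTheory Module

variable {E : Type*} [NormedAddCommGroup E] [InnerProductSpace ℝ E] [FiniteDimensional ℝ E]

/-- Nearest-point projection onto a closed convex set, with its variational characterization. -/
theorem exists_lipschitzWith_one_projection {K : Set E} (hne : K.Nonempty) (hcl : IsClosed K)
    (hconv : Convex ℝ K) :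
    ∃ P : E → E, LipschitzWith 1 P ∧ (∀ x, P x ∈ K) ∧
      ∀ x, ∀ y ∈ K, inner ℝ (x - P x) (y - P x) ≤ 0 := by
  choose P hP hmin using exists_norm_eq_iInf_of_complete_convex hne hcl.isComplete hconv
  have hvar : ∀ x, ∀ y ∈ K, inner ℝ (x - P x) (y - P x) ≤ 0 := fun x =>
    (norm_eq_iInf_iff_real_inner_le_zero hconv (hP x)).1 (hmin x)
  refine ⟨P, LipschitzWith.of_dist_le_mul fun x y => ?_, hP, hvar⟩
  have h1 := hvar x (P y) (hP y)
  have h2 := hvar y (P x) (hP x)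
  have h3 : ‖P x - P y‖ * ‖P x - P y‖ ≤ ‖x - y‖ * ‖P x - P y‖ := by
    refine le_trans ?_ (real_inner_le_norm (x - y) (P x - P y))
    rw [← real_inner_self_eq_norm_mul_norm]
    have e1 : inner ℝ (x - y) (P x - P y) - inner ℝ (P x - P y) (P x - P y) =
        -inner ℝ (x - P x) (P y - P x) - inner ℝ (y - P y) (P x - P y) := by
      simp only [inner_sub_left, inner_sub_right]
      ring
    linarith
  rw [dist_eq_norm, dist_eq_norm, NNReal.coe_one, one_mul]
  rcases (norm_nonneg (P x - P y)).eq_or_lt with h | h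
  · rw [← h]; exact norm_nonneg _
  · exact le_of_mul_le_mul_right h3 h

theorem det_one_add_pos {A : E →L[ℝ] E} (hA : ‖A‖ < 1) : 0 < (1 + A).det := by
  have hne : ∀ B ∈ ball (0 : E →L[ℝ] E) 1, (1 + B).det ≠ 0 := by
    intro B hB h0
    rw [mem_ball_zero_iff] at hB
    have hker := LinearMap.bot_lt_ker_of_det_eq_zero (f := ((1 + B : E →L[ℝ] E) : E →ₗ[ℝ] E)) h0
    obtain ⟨v, hv, hv0⟩ := Submodule.exists_mem_ne_zero_of_ne_bot hker.ne'
    have hv' : v + B v = 0 := by simpa using hv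
    have h1 : ‖v‖ = ‖B v‖ := by
      conv_lhs => rw [eq_neg_of_add_eq_zero_left hv', norm_neg]
    have h2 := B.le_opNorm v
    have h3 : 0 < ‖v‖ := norm_pos_iff.2 hv0
    nlinarith
  by_contra hle
  have hpre : IsPreconnected (ball (0 : E →L[ℝ] E) 1) := (convex_ball 0 1).isPreconnected
  have hcont : ContinuousOn (fun B : E →L[ℝ] E => (1 + B).det) (ball 0 1) :=
    (ContinuousLinearMap.continuous_det.comp (continuous_const.add continuous_id)).continuousOn
  have h1 : (fun B : E →L[ℝ] E => (1 + B).det) 0 = 1 := by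
    simp [ContinuousLinearMap.det]
  obtain ⟨B, hB, hB0⟩ := hpre.intermediate_value (a := A) (b := 0) (by simpa using hA) (by simp)
    hcont ⟨not_lt.1 hle, zero_le_one.trans h1.ge⟩
  exact hne B hB hB0

/-- `s ↦ det (1 + s A)` is a polynomial of degree at most `dim E`, hence it is recovered from its
values at more than `dim E` nodes, by a formula whose coefficients do not depend on `A`. -/
theorem det_one_add_smul_eq_sum_lagrange {ι : Type*} [DecidableEq ι] {J : Finset ι} {v : ι → ℝ}
    (hv : Set.InjOn v J) (hJ : finrank ℝ E < J.card) (A : E →L[ℝ] E) (s : ℝ) :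
    (1 + s • A).det = ∑ j ∈ J, (1 + v j • A).det * (Lagrange.basis J v j).eval s := by
  classical
  let b := finBasis ℝ E
  let M := LinearMap.toMatrix b b (A : E →ₗ[ℝ] E)
  let p : Polynomial ℝ := Matrix.det ((Polynomial.X : Polynomial ℝ) • M.map Polynomial.C +
    (1 : Matrix _ _ ℝ).map Polynomial.C)
  have hp : ∀ t : ℝ, p.eval t = (1 + t • A).det := by
    intro t
    rw [ContinuousLinearMap.det, ← LinearMap.det_toMatrix b]
    have : p.eval t = Matrix.det (t • M + 1) := by
      simp only [p]
      rw [← Polynomial.coe_evalRingHom, RingHom.map_det]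
      congr 1
      ext i j
      by_cases hij : i = j <;> simp [hij, mul_comm t]
    rw [this, add_comm]
    congr 1
    simp [M, LinearMap.toMatrix_one]
  have hdeg : p.degree < J.card := by
    refine lt_of_le_of_lt Polynomial.degree_le_natDegree ?_
    have := Polynomial.natDegree_det_X_add_C_le M (1 : Matrix _ _ ℝ)
    rw [Fintype.card_fin] at this
    exact_mod_cast this.trans_lt hJ
  have h := congrArg (Polynomial.eval s) (Lagrange.eq_interpolate hv hdeg)
  simpa [Lagrange.interpolate_apply, Polynomial.eval_finsetSum, hp] using h

/-- A small perturbation of the identity which fixes the sphere maps the ball onto itself. -/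
theorem closedBall_subset_image_add {R : ℝ} (hR : 0 < R) {φ : E → E} {C : NNReal} {t : ℝ}
    (hφ : LipschitzOnWith C φ (closedBall 0 R)) (h0 : ∀ x ∈ sphere (0 : E) R, φ x = 0)
    (ht : 0 ≤ t) (htC : t * C < 1) :
    closedBall (0 : E) R ⊆ (fun x => x + t • φ x) '' closedBall 0 R := by
  intro y hy
  obtain ⟨P, hP1, hPm, hPv⟩ := exists_lipschitzWith_one_projection (K := closedBall (0 : E) R)
    ⟨0, by simp [hR.le]⟩ isClosed_closedBall (convex_closedBall 0 R)
  have hPid : ∀ x ∈ closedBall (0 : E) R, P x = x := fun x hx =>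
    (sub_eq_zero.1 (real_inner_self_nonpos.1 (hPv x x hx))).symm
  -- from an interior point of the ball one could still move closer to `x`
  have hPsph : ∀ x ∉ closedBall (0 : E) R, P x ∈ sphere (0 : E) R := by
    intro x hx
    rw [mem_sphere_zero_iff_norm]
    by_contra hne
    have hlt : ‖P x‖ < R := lt_of_le_of_ne (by simpa using hPm x) hne
    have hnhds : closedBall (0 : E) R ∈ nhds (P x) :=
      Filter.mem_of_superset (isOpen_ball.mem_nhds (by simpa using hlt)) ball_subset_closedBall
    have hc : Filter.Tendsto (fun s : ℝ => P x + s • (x - P x)) (nhds 0) (nhds (P x)) := by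
      have : Continuous fun s : ℝ => P x + s • (x - P x) := by fun_prop
      simpa using this.tendsto 0
    have hev := hc.eventually hnhds
    obtain ⟨s, hs, hs0⟩ := ((hev.filter_mono nhdsWithin_le_nhds).and
      (self_mem_nhdsWithin : Ioi (0 : ℝ) ∈ nhdsWithin 0 (Ioi 0))).exists
    have hin := hPv x _ hs
    rw [add_sub_cancel_left, inner_smul_right] at hin
    have hz : x - P x = 0 :=
      real_inner_self_nonpos.1 (nonpos_of_mul_nonpos_right hin hs0)
    exact hx (sub_eq_zero.1 hz ▸ hPm x)
  -- the solution of `x + t φ(x) = y` is a fixed point of `x ↦ y - t φ(P x)`; outside the ball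
  -- `φ ∘ P` vanishes, so this fixed point lies in the ball
  have hcontr : ContractingWith (t.toNNReal * C) fun x => y - t • φ (P x) := by
    constructor
    · rw [← NNReal.coe_lt_coe]
      simpa [ht] using htC
    · refine LipschitzWith.of_dist_le_mul fun a b => ?_
      have h1 := hφ.dist_le_mul _ (hPm a) _ (hPm b)
      have h2 := hP1.dist_le_mul a b
      rw [NNReal.coe_one, one_mul] at h2
      rw [dist_sub_left, dist_smul₀, Real.norm_of_nonneg ht, NNReal.coe_mul, Real.coe_toNNReal _ ht,
        mul_assoc]
      exact mul_le_mul_of_nonneg_left (h1.trans (by gcongr)) ht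
  set x := ContractingWith.fixedPoint _ hcontr
  have hx : y - t • φ (P x) = x := ContractingWith.fixedPoint_isFixedPt hcontr
  have hxb : x ∈ closedBall (0 : E) R := by
    by_contra hxb
    rw [h0 _ (hPsph x hxb), smul_zero, sub_zero] at hx
    exact hxb (hx ▸ hy)
  rw [hPid x hxb] at hx
  exact ⟨x, hxb, eq_add_of_sub_eq' hx ▸ add_comm _ _⟩

/-- No-retraction theorem, `C¹` version. The integral over the ball of the Jacobian determinant of
`x ↦ x + t (r x - x)` is a polynomial in `t`. For small `t ≥ 0` it is the volume of the image, which
is the ball itself, and for `t = 1` it vanishes because `r` takes values in the sphere. -/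
theorem not_exists_contDiff_retraction {R : ℝ} (hR : 0 < R) {r : E → E}
    (hr : ∀ x ∈ closedBall (0 : E) R, ContDiffAt ℝ 1 r x)
    (hmap : ∀ x ∈ closedBall (0 : E) R, ‖r x‖ = R)
    (hid : ∀ x ∈ sphere (0 : E) R, r x = x) : False := by
  borelize E
  set φ : E → E := fun x => r x - x
  have hφ1 : ∀ x ∈ closedBall (0 : E) R, ContDiffAt ℝ 1 φ x := fun x hx =>
    (hr x hx).sub contDiffAt_id
  have hφd : ∀ x ∈ closedBall (0 : E) R, DifferentiableAt ℝ φ x := fun x hx =>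
    (hφ1 x hx).differentiableAt one_ne_zero
  have hφc : ContinuousOn (fderiv ℝ φ) (closedBall 0 R) := fun x hx =>
    ((hφ1 x hx).fderiv_right (m := 0) (by norm_num)).continuousAt.continuousWithinAt
  have hK : IsCompact (closedBall (0 : E) R) := isCompact_closedBall 0 R
  obtain ⟨C, hC1, hC⟩ : ∃ C : NNReal, 1 ≤ C ∧ ∀ x ∈ closedBall (0 : E) R, ‖fderiv ℝ φ x‖₊ ≤ C := by
    obtain ⟨C, hC⟩ := hK.exists_bound_of_continuousOn hφc
    exact ⟨max C.toNNReal 1, le_max_right _ _, fun x hx => le_trans (NNReal.coe_le_coe.1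
      ((hC x hx).trans (Real.le_coe_toNNReal C))) (le_max_left _ _)⟩
  have hlip : LipschitzOnWith C φ (closedBall 0 R) :=
    (convex_closedBall 0 R).lipschitzOnWith_of_nnnorm_fderiv_le hφd hC
  have h0 : ∀ x ∈ sphere (0 : E) R, φ x = 0 := fun x hx => sub_eq_zero.2 (hid x hx)
  let B := closedBall (0 : E) R
  have hdetc : ∀ t : ℝ, ContinuousOn (fun x => (1 + t • fderiv ℝ φ x).det) B := fun t =>
    ContinuousLinearMap.continuous_det.comp_continuousOn
      (continuousOn_const.add (hφc.const_smul t))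
  have hint : ∀ t : ℝ, IntegrableOn (fun x => (1 + t • fderiv ℝ φ x).det) B := fun t =>
    (hdetc t).integrableOn_compact hK
  -- for small `t` the map `x ↦ x + t φ(x)` is a bijection of the ball with positive Jacobian
  have hsmall : ∀ t : ℝ, 0 ≤ t → t * C < 1 →
      ∫ x in B, (1 + t • fderiv ℝ φ x).det = volume.real B := by
    intro t ht htC
    have himg : (fun x => x + t • φ x) '' B = B := by
      refine Subset.antisymm ?_ (closedBall_subset_image_add hR hlip h0 ht htC)
      rintro _ ⟨x, hx, rfl⟩
      have ht1 : t ≤ 1 := by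
        have : (1 : ℝ) ≤ C := by exact_mod_cast hC1
        nlinarith
      have hrx : r x ∈ B := mem_closedBall_zero_iff.2 (hmap x hx).le
      have := (convex_closedBall (0 : E) R).add_smul_sub_mem hx hrx ⟨ht, ht1⟩
      exact this
    have hinj : InjOn (fun x => x + t • φ x) B := by
      intro x hx y hy hxy
      have h1 : x - y = t • (φ y - φ x) := by
        rw [smul_sub, sub_eq_sub_iff_add_eq_add, add_comm (t • φ y)]
        exact hxy
      have h2 := hlip.dist_le_mul _ hy _ hx
      rw [dist_eq_norm, dist_comm, dist_eq_norm] at h2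
      have h3 : ‖x - y‖ = t * ‖φ y - φ x‖ := by rw [h1, norm_smul, Real.norm_of_nonneg ht]
      have h4 : 0 ≤ ‖x - y‖ := norm_nonneg _
      have h5 : ‖x - y‖ = 0 := by nlinarith
      exact sub_eq_zero.1 (norm_eq_zero.1 h5)
    have hder : ∀ x ∈ B, HasFDerivWithinAt (fun x => x + t • φ x) (1 + t • fderiv ℝ φ x) B x :=
      fun x hx => ((hasFDerivAt_id x).add ((hφd x hx).hasFDerivAt.const_smul t)).hasFDerivWithinAt
    have hcv := integral_image_eq_integral_abs_det_fderiv_smul volume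
      isClosed_closedBall.measurableSet hder hinj (fun _ => (1 : ℝ))
    rw [himg] at hcv
    simp only [smul_eq_mul, mul_one, integral_const, measureReal_restrict_apply_univ] at hcv
    rw [hcv]
    refine setIntegral_congr_fun isClosed_closedBall.measurableSet fun x hx => ?_
    refine (abs_of_pos (det_one_add_pos ?_)).symm
    rw [norm_smul, Real.norm_of_nonneg ht]
    exact (mul_le_mul_of_nonneg_left (NNReal.coe_le_coe.2 (hC x hx)) ht).trans_lt htC
  -- the nodes `j / ((d + 1) (C + 1))`, `j ≤ d`, are small enough for `hsmall`
  let d := finrank ℝ E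
  let v : ℕ → ℝ := fun j => j / ((d + 1) * (C + 1))
  have hden : (0 : ℝ) < (d + 1) * (C + 1) := by positivity
  have hvinj : Set.InjOn v (Finset.range (d + 1)) := by
    intro i _ j _ hij
    have : (i : ℝ) = j := by simpa [v, div_left_inj' hden.ne'] using hij
    exact_mod_cast this
  have hvsmall : ∀ j ∈ Finset.range (d + 1), v j * C < 1 := by
    intro j hj
    have hj' : (j : ℝ) < d + 1 := by exact_mod_cast Finset.mem_range.1 hj
    have hC0 : (0 : ℝ) ≤ C := C.2
    have hd0 : (0 : ℝ) ≤ d := Nat.cast_nonneg d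
    rw [show v j * C = (j * C) / ((d + 1) * (C + 1)) by simp only [v]; ring, div_lt_one hden]
    nlinarith
  have hone : ∫ x in B, (1 + (1 : ℝ) • fderiv ℝ φ x).det = volume.real B := by
    have hJ : finrank ℝ E < (Finset.range (d + 1)).card := by simp [d]
    simp only [det_one_add_smul_eq_sum_lagrange (E := E) hvinj hJ _ (1 : ℝ)]
    rw [integral_finsetSum _ fun j _ => (hint (v j)).mul_const _]
    have hsum : ∑ j ∈ Finset.range (d + 1), (Lagrange.basis (Finset.range (d + 1)) v j).eval 1 =
        (1 : ℝ) := by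
      rw [← Polynomial.eval_finsetSum, Lagrange.sum_basis hvinj (by simp), Polynomial.eval_one]
    calc _ = ∑ j ∈ Finset.range (d + 1),
          volume.real B * (Lagrange.basis (Finset.range (d + 1)) v j).eval 1 :=
          Finset.sum_congr rfl fun j hj => by
            rw [integral_mul_const, hsmall _ (by positivity) (hvsmall j hj)]
      _ = volume.real B := by rw [← Finset.mul_sum, hsum, mul_one]
  have hzero : ∀ x ∈ ball (0 : E) R, (1 + (1 : ℝ) • fderiv ℝ φ x).det = 0 := by
    intro x hx
    have hxB : x ∈ closedBall (0 : E) R := ball_subset_closedBall hx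
    have hrd := (hr x hxB).differentiableAt one_ne_zero
    have hfr : (1 + (1 : ℝ) • fderiv ℝ φ x) = fderiv ℝ r x := by
      have : fderiv ℝ φ x = fderiv ℝ r x - 1 :=
        (hrd.hasFDerivAt.sub (hasFDerivAt_id x)).fderiv
      rw [this]; simp
    rw [hfr]
    by_contra hdet
    -- differentiating `‖r‖² = R²` shows that the range of `r'(x)` is orthogonal to `r x`
    have hsq : HasFDerivAt (fun z => inner ℝ (r z) (r z)) (0 : E →L[ℝ] ℝ) x := by
      refine (hasFDerivAt_const (R * R) x).congr_of_eventuallyEq ?_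
      filter_upwards [isOpen_ball.mem_nhds hx] with z hz
      rw [real_inner_self_eq_norm_mul_norm, hmap z (ball_subset_closedBall hz)]
    have hd := hsq.unique (hrd.hasFDerivAt.inner ℝ hrd.hasFDerivAt)
    have hsurj : Function.Surjective (fderiv ℝ r x) := by
      have := LinearMap.range_eq_top.1
        ((LinearMap.equivOfDetNeZero _ hdet).range)
      exact this
    obtain ⟨u, hu⟩ := hsurj (r x)
    have h2 := DFunLike.congr_fun hd u
    simp [hu] at h2
    rw [hmap x hxB] at h2
    nlinarith
  have hzero' : ∫ x in B, (1 + (1 : ℝ) • fderiv ℝ φ x).det = 0 := by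
    rw [setIntegral_congr_set (t := ball (0 : E) R)]
    · rw [setIntegral_congr_fun isOpen_ball.measurableSet hzero]; simp
    · exact (ae_eq_of_subset_of_measure_ge ball_subset_closedBall
        (by rw [Measure.addHaar_closedBall _ _ hR.le, Measure.addHaar_ball_of_pos _ _ hR])
        isOpen_ball.measurableSet.nullMeasurableSet hK.measure_lt_top.ne).symm
  rw [hzero'] at hone
  have hpos : 0 < volume.real B := by
    refine ENNReal.toReal_pos ?_ hK.measure_lt_top.ne
    exact (measure_closedBall_pos _ _ hR).ne'
  exact hpos.ne hone

/-! ### Brouwer's fixed point theorem -/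

/-- A fixed-point-free map of the ball into its interior yields a retraction onto the sphere: push
`x` along the ray from `g x` through `x` until it meets the sphere. -/
theorem exists_fixedPoint_of_contDiff {R : ℝ} (hR : 0 < R) {g : E → E} (hg : ContDiff ℝ 1 g)
    (hgR : ∀ x, ‖g x‖ < R) : ∃ x ∈ closedBall (0 : E) R, g x = x := by
  by_contra! hne
  let u : E → E := fun x => x - g x
  let a : E → ℝ := fun x => inner ℝ x (u x)
  let b : E → ℝ := fun x => ‖u x‖ ^ 2
  -- `r x = x + s • u x`, where `s` is the larger root of `‖x + s • u x‖² = R²`; `D` is a quarter of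
  -- the discriminant
  let D : E → ℝ := fun x => a x ^ 2 + b x * (R ^ 2 - ‖x‖ ^ 2)
  let r : E → E := fun x => x + ((-a x + Real.sqrt (D x)) / b x) • u x
  have hb : ∀ x ∈ closedBall (0 : E) R, 0 < b x := fun x hx =>
    pow_pos (norm_pos_iff.2 (sub_ne_zero.2 (hne x hx).symm)) 2
  have ha : ∀ x ∈ sphere (0 : E) R, 0 < a x := by
    intro x hx
    have hx' : ‖x‖ = R := mem_sphere_zero_iff_norm.1 hx
    have h1 : a x = R ^ 2 - inner ℝ x (g x) := by
      simp only [a, u, inner_sub_right, real_inner_self_eq_norm_sq, hx']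
    have h2 := real_inner_le_norm x (g x)
    rw [hx'] at h2
    have h3 := hgR x
    rw [h1]
    nlinarith
  have hD : ∀ x ∈ closedBall (0 : E) R, 0 < D x := by
    intro x hx
    have hxR : ‖x‖ ≤ R := mem_closedBall_zero_iff.1 hx
    rcases hxR.eq_or_lt with h | h
    · have := ha x (mem_sphere_zero_iff_norm.2 h)
      simp only [D, h, sub_self, mul_zero, add_zero]
      positivity
    · have h1 := hb x hx
      have h2 : 0 < R ^ 2 - ‖x‖ ^ 2 := by nlinarith [norm_nonneg x]
      simp only [D]
      positivity
  refine not_exists_contDiff_retraction hR (r := r) ?_ ?_ ?_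
  · intro x hx
    have hu : ContDiff ℝ 1 u := contDiff_id.sub hg
    have ha' : ContDiff ℝ 1 a := contDiff_id.inner ℝ hu
    have hb' : ContDiff ℝ 1 b := hu.norm_sq ℝ
    have hD' : ContDiff ℝ 1 D :=
      (ha'.pow 2).add (hb'.mul (contDiff_const.sub (contDiff_id.norm_sq ℝ)))
    exact contDiffAt_id.add (((ha'.contDiffAt.neg.add
      (hD'.contDiffAt.sqrt (hD x hx).ne')).div hb'.contDiffAt (hb x hx).ne').smul hu.contDiffAt)
  · intro x hx
    have hb0 := hb x hx
    have hs := Real.sq_sqrt (hD x hx).le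
    have hsq : ‖r x‖ ^ 2 = R ^ 2 := by
      have h1 : ‖r x‖ ^ 2 = ‖x‖ ^ 2 + 2 * (((-a x + Real.sqrt (D x)) / b x) * a x) +
          ((-a x + Real.sqrt (D x)) / b x) ^ 2 * b x := by
        simp only [r, norm_add_sq_real, inner_smul_right, norm_smul, mul_pow, Real.norm_eq_abs,
          sq_abs, a, b]
      have h2 : Real.sqrt (D x) ^ 2 = a x ^ 2 + b x * (R ^ 2 - ‖x‖ ^ 2) := hs
      rw [h1]
      field_simp
      linear_combination h2
    exact (pow_left_inj₀ (norm_nonneg _) hR.le two_ne_zero).1 hsq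
  · intro x hx
    have hx' : ‖x‖ = R := mem_sphere_zero_iff_norm.1 hx
    have h1 : Real.sqrt (D x) = a x := by
      simp only [D, hx', sub_self, mul_zero, add_zero]
      exact Real.sqrt_sq (ha x hx).le
    simp [r, h1]

/-- Brouwer's fixed point theorem for compact convex subsets of Euclidean spaces. -/
theorem exists_fixedPoint_of_continuousOn {K : Set E} (hne : K.Nonempty) (hK : IsCompact K)
    (hconv : Convex ℝ K) {h : E → E} (hc : ContinuousOn h K) (hmap : MapsTo h K K) :
    ∃ x ∈ K, h x = x := by
  obtain ⟨P, hP1, hPm, hPv⟩ := exists_lipschitzWith_one_projection hne hK.isClosed hconv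
  have hPid : ∀ x ∈ K, P x = x := fun x hx =>
    (sub_eq_zero.1 (real_inner_self_nonpos.1 (hPv x x hx))).symm
  let f : E → E := fun x => h (P x)
  have hfK : ∀ x, f x ∈ K := fun x => hmap (hPm x)
  suffices ∃ x, f x = x by
    obtain ⟨x, hx⟩ := this
    have hxK : x ∈ K := hx ▸ hfK x
    exact ⟨x, hxK, by simpa [f, hPid x hxK] using hx⟩
  have hfu : UniformContinuous f := by
    have h1 := hK.uniformContinuousOn_of_continuous hc
    rw [← uniformContinuousOn_univ]
    exact h1.comp hP1.uniformContinuous.uniformContinuousOn fun x _ => hPm x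
  obtain ⟨R, hR0, hR⟩ : ∃ R : ℝ, 0 < R ∧ ∀ x ∈ K, ‖x‖ < R := by
    obtain ⟨R, hR⟩ := hK.isBounded.exists_norm_le
    exact ⟨max R 0 + 1, by positivity, fun x hx =>
      ((hR x hx).trans (le_max_left _ _)).trans_lt (lt_add_one _)⟩
  by_contra! hfix
  obtain ⟨x₀, _, hx₀⟩ := (isCompact_closedBall (0 : E) (R + 1)).exists_isMinOn
    ⟨0, by simp; linarith⟩ (f := fun x => dist (f x) x)
    (hfu.continuous.dist continuous_id).continuousOn
  have hδ : 0 < dist (f x₀) x₀ := dist_pos.2 (hfix x₀)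
  -- the enlarged radius `R + 1` leaves room for the smooth approximation `g` of `f`
  obtain ⟨g, hgc, hg⟩ := hfu.exists_contDiff_dist_le (lt_min hδ one_pos)
  obtain ⟨x, hx, hgx⟩ := exists_fixedPoint_of_contDiff (R := R + 1) (by linarith)
    (hgc.of_le (by exact_mod_cast le_top)) fun x => by
      have h1 := (hg x).trans_le (min_le_right _ _)
      rw [dist_eq_norm] at h1
      have h2 := norm_sub_norm_le (g x) (f x)
      have h3 := hR _ (hfK x)
      linarith
  have h1 := (hg x).trans_le (min_le_left _ _)
  rw [hgx, dist_comm] at h1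
  exact absurd (hx₀ hx) (not_le.2 h1)

/-! ### Kakutani's fixed point theorem -/

/-- Kakutani's theorem in a Euclidean space. If no `x` lies in its image, a partition of unity glues
separating functionals to a continuous `p` with `⟪p x, x⟫ < ⟪p x, y⟫` for all `y` in the image of
`x`, which contradicts the variational inequality at a fixed point of
`x ↦ proj_K (x + p x)`. -/
theorem exists_fixedPoint_of_isCompact_graph_euclidean {K : Set E} (hne : K.Nonempty)
    (hK : IsCompact K) (hconv : Convex ℝ K) {Φ : E → Set E}
    (hgraph : IsCompact {z : E × E | z.1 ∈ K ∧ z.2 ∈ Φ z.1})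
    (hΦne : ∀ x ∈ K, (Φ x).Nonempty) (hΦK : ∀ x ∈ K, Φ x ⊆ K) (hΦc : ∀ x ∈ K, Convex ℝ (Φ x)) :
    ∃ x ∈ K, x ∈ Φ x := by
  by_contra! hfix
  let t : E → Set E := fun x => {p | x ∈ K → ∀ y ∈ Φ x, inner ℝ p x < inner ℝ p y}
  have ht : ∀ x, Convex ℝ (t x) := by
    intro x p hp p' hp' α β hα hβ hαβ hx y hy
    have h1 := hp hx y hy
    have h2 := hp' hx y hy
    simp only [inner_add_left, real_inner_smul_left]
    rcases hα.eq_or_lt with h | h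
    · obtain rfl : β = 1 := by linarith
      simpa [← h] using h2
    · nlinarith
  have hloc : ∀ x, ∃ p, ∀ᶠ x' in nhds x, p ∈ t x' := by
    intro x
    by_cases hx : x ∈ K
    · have hcl : IsClosed (Φ x) := by
        have : Φ x = (fun y => (x, y)) ⁻¹' {z : E × E | z.1 ∈ K ∧ z.2 ∈ Φ z.1} := by
          ext y; simp [hx]
        rw [this]
        exact hgraph.isClosed.preimage (by fun_prop)
      obtain ⟨ℓ, c, hc1, hc2⟩ := geometric_hahn_banach_point_closed (hΦc x hx) hcl (hfix x hx)
      obtain ⟨p, hp⟩ := (InnerProductSpace.toDual ℝ E).surjective ℓ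
      have hℓ : ∀ z, ℓ z = inner ℝ p z := fun z => by rw [← hp]; simp
      -- near `x` the whole image stays in the half-space `c < ⟪p, ·⟫`
      have hbad : IsClosed (Prod.fst '' ({z : E × E | z.1 ∈ K ∧ z.2 ∈ Φ z.1} ∩
          {z | inner ℝ p z.2 ≤ c})) :=
        ((hgraph.inter_right (isClosed_le (by fun_prop) continuous_const)).image
          continuous_fst).isClosed
      have hx1 : x ∈ (Prod.fst '' ({z : E × E | z.1 ∈ K ∧ z.2 ∈ Φ z.1} ∩
          {z | inner ℝ p z.2 ≤ c}))ᶜ := by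
        rintro ⟨⟨_, y⟩, ⟨⟨_, hy⟩, hyc⟩, rfl⟩
        have := hc2 y hy
        rw [hℓ] at this
        exact absurd hyc (not_le.2 this)
      have hx2 : ∀ᶠ x' in nhds x, inner ℝ p x' < c :=
        (isOpen_lt (by fun_prop) continuous_const).mem_nhds (by simpa [hℓ] using hc1)
      refine ⟨p, ?_⟩
      filter_upwards [hbad.isOpen_compl.mem_nhds hx1, hx2] with x' h1 h2 hx' y hy
      refine h2.trans (not_le.1 fun hle => h1 ⟨(x', y), ⟨⟨hx', hy⟩, hle⟩, rfl⟩)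
    · refine ⟨0, ?_⟩
      filter_upwards [hK.isClosed.isOpen_compl.mem_nhds hx] with x' hx' hx''
      exact absurd hx'' hx'
  obtain ⟨p, hp⟩ := exists_continuous_forall_mem_convex_of_local_const ht hloc
  obtain ⟨P, hP1, hPm, hPv⟩ := exists_lipschitzWith_one_projection hne hK.isClosed hconv
  obtain ⟨x, hx, hfx⟩ := exists_fixedPoint_of_continuousOn hne hK hconv (h := fun x => P (x + p x))
    (hP1.continuous.comp (continuous_id.add p.continuous)).continuousOn fun x _ => hPm _
  obtain ⟨y, hy⟩ := hΦne x hx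
  have h1 := hp x hx y hy
  have h2 := hPv (x + p x) y (hΦK x hx hy)
  rw [hfx, add_sub_cancel_left, inner_sub_right] at h2
  linarith

end Brouwer

/-- Kakutani's fixed point theorem in a finite-dimensional normed space. -/
theorem exists_fixedPoint_of_isCompact_graph {V : Type*} [NormedAddCommGroup V] [NormedSpace ℝ V]
    [FiniteDimensional ℝ V] {K : Set V} (hne : K.Nonempty)
    (hK : IsCompact K) (hconv : Convex ℝ K) {Φ : V → Set V}
    (hgraph : IsCompact {z : V × V | z.1 ∈ K ∧ z.2 ∈ Φ z.1})
    (hΦne : ∀ x ∈ K, (Φ x).Nonempty) (hΦK : ∀ x ∈ K, Φ x ⊆ K) (hΦc : ∀ x ∈ K, Convex ℝ (Φ x)) :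
    ∃ x ∈ K, x ∈ Φ x := by
  let e : V ≃L[ℝ] _ := toEuclidean (E := V)
  have hgr : {z | z.1 ∈ e '' K ∧ z.2 ∈ e '' Φ (e.symm z.1)} =
      Prod.map e e '' {z : V × V | z.1 ∈ K ∧ z.2 ∈ Φ z.1} := by
    ext ⟨a, b⟩
    constructor
    · rintro ⟨⟨x, hx, rfl⟩, ⟨y, hy, rfl⟩⟩
      exact ⟨(x, y), ⟨hx, by simpa using hy⟩, rfl⟩
    · rintro ⟨⟨x, y⟩, ⟨hx, hy⟩, h⟩
      obtain ⟨rfl, rfl⟩ := Prod.mk.inj h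
      exact ⟨⟨x, hx, rfl⟩, ⟨y, by simpa using hy, rfl⟩⟩
  obtain ⟨_, ⟨x, hx, rfl⟩, hfix⟩ := exists_fixedPoint_of_isCompact_graph_euclidean (hne.image e)
    (hK.image e.continuous) (hconv.linear_image e.toLinearMap) (Φ := fun z => e '' Φ (e.symm z))
    (hgr ▸ hgraph.image (e.continuous.prodMap e.continuous))
    (by rintro _ ⟨x, hx, rfl⟩; simpa using hΦne x hx)
    (by rintro _ ⟨x, hx, rfl⟩; rw [e.symm_apply_apply]; exact Set.image_mono (hΦK x hx))
    (by rintro _ ⟨x, hx, rfl⟩; simpa using (hΦc x hx).linear_image e.toLinearMap)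
  exact ⟨x, hx, by simpa using hfix⟩

/-! ### Maximizers of continuous functions over continuous set-valued maps -/

section Argmax

open Set Filter Topology

variable {Z B C : Type*} [TopologicalSpace Z] [TopologicalSpace B] [TopologicalSpace C]

theorem UpperHemicontinuousOn.isClosed_graph [RegularSpace B] {F : Z → Set B} {A : Set Z}
    (hF : UpperHemicontinuousOn F A) (hA : IsClosed A) (hcl : ∀ a ∈ A, IsClosed (F a)) :
    IsClosed {z : Z × B | z.1 ∈ A ∧ z.2 ∈ F z.1} := by
  rw [← isOpen_compl_iff, isOpen_iff_mem_nhds]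
  rintro ⟨a, b⟩ hab
  rw [nhds_prod_eq]
  by_cases ha : a ∈ A
  · have hb : b ∉ F a := fun hb => hab ⟨ha, hb⟩
    obtain ⟨s, hs, t, ht, hst⟩ := Filter.disjoint_iff.1 (RegularSpace.regular (hcl a ha) hb)
    have h1 : ∀ᶠ a' in 𝓝 a, a' ∈ A → s ∈ 𝓝ˢ (F a') :=
      eventually_nhdsWithin_iff.1 (hF a ha s hs)
    filter_upwards [prod_mem_prod h1 ht]
    rintro ⟨a', b'⟩ ⟨h2, h3⟩ ⟨h4, h5⟩
    exact hst.notMem_of_mem_left (subset_of_mem_nhdsSet (h2 h4) h5) h3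
  · filter_upwards [prod_mem_prod (hA.isOpen_compl.mem_nhds ha) univ_mem]
    rintro ⟨a', b'⟩ ⟨h2, _⟩ ⟨h4, _⟩
    exact h2 h4

theorem ContinuousSetValuedOn.comp {F : B → Set C} {D : Set B} (hF : ContinuousSetValuedOn F D)
    {A : Set Z} {k : Z → B} (hk : Continuous k) (hmap : MapsTo k A D) :
    ContinuousSetValuedOn (fun z => F (k z)) A := by
  have ht : ∀ z ∈ A, Tendsto k (𝓝[A] z) (𝓝[D] (k z)) := fun z _ =>
    (hk.continuousWithinAt (s := A)).tendsto_nhdsWithin hmap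
  exact ⟨fun z hz t h => (ht z hz).eventually (hF.1 (k z) (hmap hz) t h),
    fun z hz t h => (ht z hz).eventually (hF.2 (k z) (hmap hz) t h)⟩

theorem LowerHemicontinuousOn.dependent_prod {Φ : Z → Set B} {Ψ : Z × B → Set C} {A : Set Z}
    {D : Set (Z × B)} (hΦ : LowerHemicontinuousOn Φ A) (hΨ : LowerHemicontinuousOn Ψ D)
    (hD : ∀ z ∈ A, ∀ u ∈ Φ z, (z, u) ∈ D) :
    LowerHemicontinuousOn (fun z => {b : B × C | b.1 ∈ Φ z ∧ b.2 ∈ Ψ (z, b.1)}) A := by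
  intro z hz
  refine lowerHemicontinuousWithinAt_iff.2 ?_
  rintro O hO ⟨⟨u, v⟩, ⟨hu, hv⟩, huv⟩
  obtain ⟨O₁, O₂, hO₁, hO₂, hu₁, hv₂, hsub⟩ := isOpen_prod_iff.1 hO u v huv
  have h1 := eventually_nhdsWithin_iff.1
    (lowerHemicontinuousWithinAt_iff.1 (hΨ (z, u) (hD z hz u hu)) O₂ hO₂ ⟨v, hv, hv₂⟩)
  obtain ⟨N, M, hN, hzN, hM, huM, hNM⟩ := mem_nhds_prod_iff'.1 h1
  have h2 := lowerHemicontinuousWithinAt_iff.1 (hΦ z hz) (O₁ ∩ M) (hO₁.inter hM) ⟨u, hu, hu₁, huM⟩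
  filter_upwards [h2, self_mem_nhdsWithin, mem_nhdsWithin_of_mem_nhds (hN.mem_nhds hzN)]
  rintro z' ⟨u', hu', hu'₁, hu'M⟩ hz' hz'N
  obtain ⟨v', hv', hv'₂⟩ := hNM (mk_mem_prod hz'N hu'M) (hD z' hz' u' hu')
  exact ⟨(u', v'), ⟨hu', hv'⟩, hsub (mk_mem_prod hu'₁ hv'₂)⟩

/-- Berge's maximum theorem: the set of pairs of a parameter and a maximizer is compact. -/
theorem isCompact_graph_argmax [T2Space Z] [T2Space B] {A : Set Z} {K : Z → Set B} {F : Z × B → ℝ}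
    (hgraph : IsCompact {z : Z × B | z.1 ∈ A ∧ z.2 ∈ K z.1}) (hK : LowerHemicontinuousOn K A)
    (hF : ContinuousOn F {z | z.1 ∈ A ∧ z.2 ∈ K z.1}) :
    IsCompact {z : Z × B | z.1 ∈ A ∧ z.2 ∈ K z.1 ∧ ∀ b ∈ K z.1, F (z.1, b) ≤ F z} := by
  refine hgraph.of_isClosed_subset (isClosed_of_closure_subset fun z hz => ?_)
    fun z hz => ⟨hz.1, hz.2.1⟩
  have hzg : z.1 ∈ A ∧ z.2 ∈ K z.1 :=
    closure_minimal (t := {z : Z × B | z.1 ∈ A ∧ z.2 ∈ K z.1}) (fun z hz => ⟨hz.1, hz.2.1⟩)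
      hgraph.isClosed hz
  refine ⟨hzg.1, hzg.2, fun b hb => not_lt.1 fun hlt => ?_⟩
  obtain ⟨c, hc₁, hc₂⟩ := exists_between hlt
  have h1 := eventually_nhdsWithin_iff.1 ((hF z hzg).eventually (gt_mem_nhds hc₁))
  have h2 := eventually_nhdsWithin_iff.1 ((hF (z.1, b) ⟨hzg.1, hb⟩).eventually (lt_mem_nhds hc₂))
  obtain ⟨N, M, hN, hzN, hM, hbM, hNM⟩ := mem_nhds_prod_iff'.1 h2
  have h3 := eventually_nhdsWithin_iff.1
    (lowerHemicontinuousWithinAt_iff.1 (hK z.1 hzg.1) M hM ⟨b, hb, hbM⟩)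
  have h4 : ∀ᶠ z' : Z × B in 𝓝 z, (z'.1 ∈ A → (K z'.1 ∩ M).Nonempty) ∧ z'.1 ∈ N :=
    (continuous_fst.tendsto z).eventually (h3.and (hN.mem_nhds hzN))
  obtain ⟨z', hz', h5, h6, h7⟩ := ((mem_closure_iff_frequently.1 hz).and_eventually
    (h1.and h4)).exists
  obtain ⟨b', hb', hb'M⟩ := h6 hz'.1
  exact lt_asymm (h5 ⟨hz'.1, hz'.2.1⟩)
    ((hNM (mk_mem_prod h7 hb'M) ⟨hz'.1, hb'⟩).trans_le (hz'.2.2 b' hb'))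

/-- The optimal first-stage decisions `u ∈ Φ z` of an optimistic decision maker: for some reaction
`v ∈ Ψ z u`, the pair `(u, v)` maximizes `F z` over all feasible pairs. -/
def bestResponses (Φ : Z → Set B) (Ψ : Z → B → Set C) (F : Z → B → C → ℝ) (z : Z) : Set B :=
  {u | u ∈ Φ z ∧ ∃ v ∈ Ψ z u, ∀ u' ∈ Φ z, ∀ v' ∈ Ψ z u', F z u' v' ≤ F z u v}

variable {Φ : Z → Set B} {Ψ : Z → B → Set C} {F : Z → B → C → ℝ} {A : Set Z} {B₀ : Set B}
  {C₀ : Set C}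

theorem isCompact_graph_dependent_prod [T2Space Z] [T2Space B] [T2Space C] [RegularSpace B]
    [RegularSpace C] (hA : IsCompact A) (hB₀ : IsCompact B₀)
    (hC₀ : IsCompact C₀) (hΦ : ContinuousSetValuedOn Φ A) (hΦc : ∀ z ∈ A, IsCompact (Φ z))
    (hΦB : ∀ z ∈ A, Φ z ⊆ B₀)
    (hΨ : ContinuousSetValuedOn (fun p : Z × B => Ψ p.1 p.2) (A ×ˢ B₀))
    (hΨc : ∀ z ∈ A, ∀ u ∈ B₀, IsCompact (Ψ z u)) (hΨC : ∀ z ∈ A, ∀ u ∈ B₀, Ψ z u ⊆ C₀) :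
    IsCompact {p : Z × (B × C) | p.1 ∈ A ∧ p.2.1 ∈ Φ p.1 ∧ p.2.2 ∈ Ψ p.1 p.2.1} := by
  have h1 := hΦ.1.isClosed_graph hA.isClosed fun z hz => (hΦc z hz).isClosed
  have h2 := hΨ.1.isClosed_graph (hA.prod hB₀).isClosed fun p hp => (hΨc p.1 hp.1 p.2 hp.2).isClosed
  refine (hA.prod (hB₀.prod hC₀)).of_isClosed_subset ?_
    fun p hp => ⟨hp.1, hΦB _ hp.1 hp.2.1, hΨC _ hp.1 _ (hΦB _ hp.1 hp.2.1) hp.2.2⟩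
  have h3 := (h1.preimage (f := fun p : Z × (B × C) => (p.1, p.2.1)) (by fun_prop)).inter
    (h2.preimage (f := fun p : Z × (B × C) => ((p.1, p.2.1), p.2.2)) (by fun_prop))
  convert h3 using 1
  ext p
  exact ⟨fun h => ⟨⟨h.1, h.2.1⟩, ⟨h.1, hΦB _ h.1 h.2.1⟩, h.2.2⟩, fun h => ⟨h.1.1, h.1.2, h.2.2⟩⟩

theorem isCompact_graph_bestResponses [T2Space Z] [T2Space B] [T2Space C] [RegularSpace B]
    [RegularSpace C] (hA : IsCompact A) (hB₀ : IsCompact B₀)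
    (hC₀ : IsCompact C₀) (hΦ : ContinuousSetValuedOn Φ A) (hΦc : ∀ z ∈ A, IsCompact (Φ z))
    (hΦB : ∀ z ∈ A, Φ z ⊆ B₀)
    (hΨ : ContinuousSetValuedOn (fun p : Z × B => Ψ p.1 p.2) (A ×ˢ B₀))
    (hΨc : ∀ z ∈ A, ∀ u ∈ B₀, IsCompact (Ψ z u)) (hΨC : ∀ z ∈ A, ∀ u ∈ B₀, Ψ z u ⊆ C₀)
    (hF : ContinuousOn (fun p : Z × (B × C) => F p.1 p.2.1 p.2.2) (A ×ˢ B₀ ×ˢ C₀)) :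
    IsCompact {p : Z × B | p.1 ∈ A ∧ p.2 ∈ bestResponses Φ Ψ F p.1} := by
  have hgr := isCompact_graph_dependent_prod hA hB₀ hC₀ hΦ hΦc hΦB hΨ hΨc hΨC
  have hlow := hΦ.2.dependent_prod hΨ.2 fun z hz u hu => ⟨hz, hΦB z hz hu⟩
  have h := isCompact_graph_argmax (F := fun p : Z × (B × C) => F p.1 p.2.1 p.2.2) hgr hlow
    (hF.mono fun p hp => ⟨hp.1, hΦB _ hp.1 hp.2.1, hΨC _ hp.1 _ (hΦB _ hp.1 hp.2.1) hp.2.2⟩)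
  convert h.image (f := fun p : Z × (B × C) => (p.1, p.2.1)) (by fun_prop) using 1
  ext ⟨z, u⟩
  constructor
  · rintro ⟨hz, hu, v, hv, hmax⟩
    exact ⟨(z, (u, v)), ⟨hz, ⟨hu, hv⟩, fun b hb => hmax _ hb.1 _ hb.2⟩, rfl⟩
  · rintro ⟨⟨z', u', v⟩, ⟨hz, ⟨hu, hv⟩, hmax⟩, h⟩
    obtain ⟨rfl, rfl⟩ := Prod.mk.inj h
    exact ⟨hz, hu, v, hv, fun a ha b hb => hmax (a, b) ⟨ha, hb⟩⟩

theorem bestResponses_nonempty [T2Space Z] [T2Space B] [T2Space C] [RegularSpace B]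
    [RegularSpace C] (hA : IsCompact A) (hB₀ : IsCompact B₀)
    (hC₀ : IsCompact C₀) (hΦ : ContinuousSetValuedOn Φ A) (hΦc : ∀ z ∈ A, IsCompact (Φ z))
    (hΦB : ∀ z ∈ A, Φ z ⊆ B₀)
    (hΨ : ContinuousSetValuedOn (fun p : Z × B => Ψ p.1 p.2) (A ×ˢ B₀))
    (hΨc : ∀ z ∈ A, ∀ u ∈ B₀, IsCompact (Ψ z u)) (hΨC : ∀ z ∈ A, ∀ u ∈ B₀, Ψ z u ⊆ C₀)
    (hF : ContinuousOn (fun p : Z × (B × C) => F p.1 p.2.1 p.2.2) (A ×ˢ B₀ ×ˢ C₀))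
    {z : Z} (hz : z ∈ A) (hne : ∃ u ∈ Φ z, (Ψ z u).Nonempty) :
    (bestResponses Φ Ψ F z).Nonempty := by
  have hgr := isCompact_graph_dependent_prod hA hB₀ hC₀ hΦ hΦc hΦB hΨ hΨc hΨC
  have hcomp := (hgr.inter_right (isClosed_singleton (x := z).preimage continuous_fst))
  obtain ⟨u₀, hu₀, v₀, hv₀⟩ := hne
  obtain ⟨⟨z', u, v⟩, ⟨⟨_, hu, hv⟩, rfl⟩, hmax⟩ := hcomp.exists_isMaxOn
    (f := fun p : Z × (B × C) => F p.1 p.2.1 p.2.2)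
    ⟨(z, (u₀, v₀)), ⟨hz, hu₀, hv₀⟩, rfl⟩
    (hF.mono fun p hp => ⟨hp.1.1, hΦB _ hp.1.1 hp.1.2.1,
      hΨC _ hp.1.1 _ (hΦB _ hp.1.1 hp.1.2.1) hp.1.2.2⟩)
  exact ⟨u, hu, v, hv, fun u' hu' v' hv' => hmax (a := (z', (u', v'))) ⟨⟨hz, hu', hv'⟩, rfl⟩⟩

theorem convex_bestResponses {Z B C : Type*} [AddCommGroup B] [Module ℝ B] [AddCommGroup C]
    [Module ℝ C] {Φ : Z → Set B} {Ψ : Z → B → Set C} {F : Z → B → C → ℝ} {z : Z} {s : Set (B × C)}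
    (hconv : Convex ℝ {b : B × C | b.1 ∈ Φ z ∧ b.2 ∈ Ψ z b.1})
    (hs : {b : B × C | b.1 ∈ Φ z ∧ b.2 ∈ Ψ z b.1} ⊆ s)
    (hF : QuasiconcaveOn ℝ s fun b => F z b.1 b.2) : Convex ℝ (bestResponses Φ Ψ F z) := by
  rintro u₁ ⟨hu₁, v₁, hv₁, h₁⟩ u₂ ⟨hu₂, v₂, hv₂, h₂⟩ a b ha hb hab
  have hm₁ : (u₁, v₁) ∈ {b : B × C | b.1 ∈ Φ z ∧ b.2 ∈ Ψ z b.1} := ⟨hu₁, hv₁⟩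
  have hm₂ : (u₂, v₂) ∈ {b : B × C | b.1 ∈ Φ z ∧ b.2 ∈ Ψ z b.1} := ⟨hu₂, hv₂⟩
  obtain ⟨hu, hv⟩ := hconv hm₁ hm₂ ha hb hab
  have hval := (hF (F z u₁ v₁) ⟨hs hm₁, le_rfl⟩ ⟨hs hm₂, h₂ _ hu₁ _ hv₁⟩ ha hb hab).2
  exact ⟨hu, _, hv, fun u' hu' v' hv' => (h₁ u' hu' v' hv').trans hval⟩

end Argmax

/-! ### Equilibria -/

namespace NSNGame

open Set

variable {n : ℕ} {d : Fin n → ℕ} {p q : ℕ}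

theorem update_mem_XProd {Θ : NSNGame n d p q} {x : Profile d} (hx : x ∈ Θ.XProd) {i : Fin n}
    {u : Eucl (d i)} (hu : u ∈ Θ.X i) : Function.update x i u ∈ Θ.XProd := by
  intro j
  rcases eq_or_ne j i with rfl | h
  · simpa using hu
  · simpa [h] using hx j

theorem rivals_mem_XRivals {Θ : NSNGame n d p q} {x : Profile d} (hx : x ∈ Θ.XProd) (i : Fin n) :
    rivals i x ∈ Θ.XRivals i := fun j => hx j

/-- The fixed points of the product of all best-response maps, that of the uncertainty player
included, give an equilibrium in which the uncertain factor minimizes a scalar cost `g`. -/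
theorem exists_leaderConditions_minimizing (Θ : NSNGame n d p q)
    (hX : ∀ i, (Θ.X i).Nonempty ∧ IsCompact (Θ.X i) ∧ Convex ℝ (Θ.X i))
    (hY : IsCompact Θ.Y) (hW : Θ.W.Nonempty ∧ IsCompact Θ.W ∧ Convex ℝ Θ.W)
    (hmap : Θ.MapAssumption)
    (hqc : ∀ i, ∀ x ∈ Θ.XProd, ∀ w ∈ Θ.W, QuasiconcaveOn ℝ (Θ.X i ×ˢ Θ.Y)
      (fun z : Eucl (d i) × Eucl p => Θ.f i (Function.update x i z.1) z.2 w))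
    (hfc : ∀ i, ContinuousOn (fun z : Profile d × Eucl p × Eucl q => Θ.f i z.1 z.2.1 z.2.2)
      (Θ.XProd ×ˢ Θ.Y ×ˢ Θ.W))
    {g : Profile d → Eucl p → Eucl q → ℝ}
    (hg : ∀ x ∈ Θ.XProd, ConcaveOn ℝ (Θ.Y ×ˢ Θ.W) (fun z : Eucl p × Eucl q => - g x z.1 z.2))
    (hgc : ContinuousOn (fun z : Profile d × Eucl p × Eucl q => g z.1 z.2.1 z.2.2)
      (Θ.XProd ×ˢ Θ.Y ×ˢ Θ.W)) :
    ∃ (x : Profile d) (w : Eucl q) (y : Fin n → Eucl p) (yw : Eucl p),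
      Θ.LeaderConditions x w y ∧ yw ∈ Θ.G x w ∧ ∀ t ∈ Θ.unc x, ∀ v ∈ Θ.G x t, g x yw w ≤ g x v t := by
  have hXpi : Θ.XProd = Set.univ.pi Θ.X := by ext x; simp [XProd]
  have hXc : IsCompact Θ.XProd := hXpi ▸ isCompact_univ_pi fun i => (hX i).2.1
  have hXconv : Convex ℝ Θ.XProd := hXpi ▸ convex_pi fun i _ => (hX i).2.2
  have hXne : Θ.XProd.Nonempty := hXpi ▸ univ_pi_nonempty_iff.2 fun i => (hX i).1
  let K : Set (Profile d × Eucl q) := Θ.XProd ×ˢ Θ.W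
  have hK : IsCompact K := hXc.prod hW.2.1
  -- the two-stage decision problem of leader `i`
  let Φ : ∀ i : Fin n, Profile d × Eucl q → Set (Eucl (d i)) := fun i z => Θ.feas i (rivals i z.1)
  let Ψ : ∀ i : Fin n, Profile d × Eucl q → Eucl (d i) → Set (Eucl p) := fun i z u =>
    Θ.G (Function.update z.1 i u) z.2
  let F : ∀ i : Fin n, Profile d × Eucl q → Eucl (d i) → Eucl p → ℝ := fun i z u v =>
    Θ.f i (Function.update z.1 i u) v z.2
  have hΦ : ∀ i, ContinuousSetValuedOn (Φ i) K := fun i =>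
    (hmap.feas_continuous i).comp (k := fun z : Profile d × Eucl q => rivals i z.1)
      (continuous_pi fun j => (continuous_apply j.1).comp continuous_fst)
      fun z hz => rivals_mem_XRivals hz.1 i
  have hΦc : ∀ i, ∀ z ∈ K, IsCompact (Φ i z) := fun i z hz =>
    hmap.feas_compact i _ (rivals_mem_XRivals hz.1 i)
  have hΦX : ∀ i, ∀ z ∈ K, Φ i z ⊆ Θ.X i := fun i z hz =>
    (Θ.feas_map i _ (rivals_mem_XRivals hz.1 i)).2
  have hΨ : ∀ i, ContinuousSetValuedOn
      (fun r : (Profile d × Eucl q) × Eucl (d i) => Ψ i r.1 r.2) (K ×ˢ Θ.X i) := fun i =>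
    hmap.G_continuous.comp
      (k := fun r : (Profile d × Eucl q) × Eucl (d i) => (Function.update r.1.1 i r.2, r.1.2))
      (by fun_prop) fun r hr => ⟨update_mem_XProd hr.1.1 hr.2, hr.1.2⟩
  have hΨc : ∀ i, ∀ z ∈ K, ∀ u ∈ Θ.X i, IsCompact (Ψ i z u) := fun i z hz u hu =>
    hmap.G_compact _ (update_mem_XProd hz.1 hu) _ hz.2
  have hΨne : ∀ i, ∀ z ∈ K, ∀ u ∈ Θ.X i, (Ψ i z u).Nonempty := fun i z hz u hu =>
    (Θ.G_map (Function.update z.1 i u, z.2) ⟨update_mem_XProd hz.1 hu, hz.2⟩).1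
  have hΨY : ∀ i, ∀ z ∈ K, ∀ u ∈ Θ.X i, Ψ i z u ⊆ Θ.Y := fun i z hz u hu =>
    (Θ.G_map (Function.update z.1 i u, z.2) ⟨update_mem_XProd hz.1 hu, hz.2⟩).2
  have hF : ∀ i, ContinuousOn
      (fun r : (Profile d × Eucl q) × (Eucl (d i) × Eucl p) => F i r.1 r.2.1 r.2.2)
      (K ×ˢ Θ.X i ×ˢ Θ.Y) := fun i =>
    (hfc i).comp
      (f := fun r : (Profile d × Eucl q) × (Eucl (d i) × Eucl p) =>
        (Function.update r.1.1 i r.2.1, r.2.2, r.1.2))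
      (by fun_prop) fun r hr => ⟨update_mem_XProd hr.1.1 hr.2.1, hr.2.2, hr.1.2⟩
  -- the two-stage decision problem of the uncertainty player
  let Φ' : Profile d × Eucl q → Set (Eucl q) := fun z => Θ.unc z.1
  let Ψ' : Profile d × Eucl q → Eucl q → Set (Eucl p) := fun z t => Θ.G z.1 t
  let F' : Profile d × Eucl q → Eucl q → Eucl p → ℝ := fun z t v => - g z.1 v t
  have hΦ' : ContinuousSetValuedOn Φ' K :=
    hmap.unc_continuous.comp continuous_fst fun z hz => hz.1
  have hΦc' : ∀ z ∈ K, IsCompact (Φ' z) := fun z hz => hmap.unc_compact _ hz.1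
  have hΦW : ∀ z ∈ K, Φ' z ⊆ Θ.W := fun z hz => (Θ.unc_map _ hz.1).2
  have hΨ' : ContinuousSetValuedOn
      (fun r : (Profile d × Eucl q) × Eucl q => Ψ' r.1 r.2) (K ×ˢ Θ.W) :=
    hmap.G_continuous.comp (k := fun r : (Profile d × Eucl q) × Eucl q => (r.1.1, r.2))
      (by fun_prop) fun r hr => ⟨hr.1.1, hr.2⟩
  have hΨc' : ∀ z ∈ K, ∀ t ∈ Θ.W, IsCompact (Ψ' z t) := fun z hz t ht =>
    hmap.G_compact _ hz.1 _ ht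
  have hΨY' : ∀ z ∈ K, ∀ t ∈ Θ.W, Ψ' z t ⊆ Θ.Y := fun z hz t ht => (Θ.G_map (z.1, t) ⟨hz.1, ht⟩).2
  have hF' : ContinuousOn
      (fun r : (Profile d × Eucl q) × (Eucl q × Eucl p) => F' r.1 r.2.1 r.2.2)
      (K ×ˢ Θ.W ×ˢ Θ.Y) :=
    (hgc.comp (f := fun r : (Profile d × Eucl q) × (Eucl q × Eucl p) => (r.1.1, r.2.2, r.2.1))
      (by fun_prop) fun r hr => ⟨hr.1.1, hr.2.2, hr.2.1⟩).neg
  let BR : Profile d × Eucl q → Set (Profile d × Eucl q) := fun z =>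
    {z' | (∀ i, z'.1 i ∈ bestResponses (Φ i) (Ψ i) (F i) z) ∧ z'.2 ∈ bestResponses Φ' Ψ' F' z}
  have hBRK : ∀ z ∈ K, BR z ⊆ K := fun z hz z' hz' =>
    ⟨fun i => hΦX i z hz (hz'.1 i).1, hΦW z hz hz'.2.1⟩
  have hgraph : IsCompact
      {z : (Profile d × Eucl q) × (Profile d × Eucl q) | z.1 ∈ K ∧ z.2 ∈ BR z.1} := by
    refine (hK.prod hK).of_isClosed_subset ?_ fun z hz => ⟨hz.1, hBRK _ hz.1 hz.2⟩
    have h1 : IsClosed (⋂ i, (fun z : (Profile d × Eucl q) × (Profile d × Eucl q) =>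
        (z.1, z.2.1 i)) ⁻¹' {r | r.1 ∈ K ∧ r.2 ∈ bestResponses (Φ i) (Ψ i) (F i) r.1}) :=
      isClosed_iInter fun i =>
        (isCompact_graph_bestResponses hK (hX i).2.1 hY (hΦ i) (hΦc i) (hΦX i) (hΨ i) (hΨc i)
          (hΨY i) (hF i)).isClosed.preimage (by fun_prop)
    have h2 : IsClosed ((fun z : (Profile d × Eucl q) × (Profile d × Eucl q) =>
        (z.1, z.2.2)) ⁻¹' {r | r.1 ∈ K ∧ r.2 ∈ bestResponses Φ' Ψ' F' r.1}) :=
      (isCompact_graph_bestResponses hK hW.2.1 hY hΦ' hΦc' hΦW hΨ' hΨc'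
        hΨY' hF').isClosed.preimage (by fun_prop)
    convert h1.inter h2 using 1
    ext z
    simp only [mem_inter_iff, mem_iInter, mem_preimage, mem_ofPred_eq, BR]
    exact ⟨fun h => ⟨fun i => ⟨h.1, h.2.1 i⟩, h.1, h.2.2⟩,
      fun h => ⟨h.2.1, fun i => (h.1 i).2, h.2.2⟩⟩
  have hBRne : ∀ z ∈ K, (BR z).Nonempty := by
    intro z hz
    have h1 : ∀ i, (bestResponses (Φ i) (Ψ i) (F i) z).Nonempty := fun i => by
      obtain ⟨u, hu⟩ := (Θ.feas_map i _ (rivals_mem_XRivals hz.1 i)).1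
      exact bestResponses_nonempty hK (hX i).2.1 hY (hΦ i) (hΦc i) (hΦX i) (hΨ i) (hΨc i)
        (hΨY i) (hF i) hz ⟨u, hu, hΨne i z hz u (hΦX i z hz hu)⟩
    have h2 : (bestResponses Φ' Ψ' F' z).Nonempty := by
      obtain ⟨t, ht⟩ := (Θ.unc_map _ hz.1).1
      exact bestResponses_nonempty hK hW.2.1 hY hΦ' hΦc' hΦW hΨ' hΨc' hΨY' hF' hz
        ⟨t, ht, (Θ.G_map (z.1, t) ⟨hz.1, hΦW z hz ht⟩).1⟩
    choose u hu using h1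
    obtain ⟨t, ht⟩ := h2
    exact ⟨(u, t), hu, ht⟩
  have hBRconv : ∀ z ∈ K, Convex ℝ (BR z) := by
    intro z hz
    have h1 : ∀ i, Convex ℝ (bestResponses (Φ i) (Ψ i) (F i) z) := by
      intro i
      refine convex_bestResponses (s := Θ.X i ×ˢ Θ.Y) ?_
        (fun b hb => ⟨hΦX i z hz hb.1, hΨY i z hz _ (hΦX i z hz hb.1) hb.2⟩)
        (hqc i z.1 hz.1 z.2 hz.2)
      rintro ⟨u₁, v₁⟩ ⟨hu₁, hv₁⟩ ⟨u₂, v₂⟩ ⟨hu₂, hv₂⟩ a b ha hb hab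
      have hgr : ∀ u ∈ Φ i z, ∀ v ∈ Ψ i z u, ((Function.update z.1 i u, z.2), v) ∈ Θ.graphG :=
        fun u hu v hv => ⟨⟨update_mem_XProd hz.1 (hΦX i z hz hu), hz.2⟩,
          hΨY i z hz u (hΦX i z hz hu) hv, hv⟩
      have h := (hmap.G_convex (hgr u₁ hu₁ v₁ hv₁) (hgr u₂ hu₂ v₂ hv₂) ha hb hab).2.2
      refine ⟨hmap.feas_convex i _ (rivals_mem_XRivals hz.1 i) hu₁ hu₂ ha hb hab, ?_⟩
      have e1 : a • Function.update z.1 i u₁ + b • Function.update z.1 i u₂ =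
          Function.update z.1 i (a • u₁ + b • u₂) := by
        rw [← Function.update_smul, ← Function.update_smul, ← Function.update_add, ← add_smul, hab,
          one_smul]
      have e2 : a • z.2 + b • z.2 = z.2 := by rw [← add_smul, hab, one_smul]
      simpa [Ψ, e1, e2] using h
    have h2 : Convex ℝ (bestResponses Φ' Ψ' F' z) := by
      refine convex_bestResponses (s := Θ.W ×ˢ Θ.Y) ?_
        (fun b hb => ⟨hΦW z hz hb.1, hΨY' z hz _ (hΦW z hz hb.1) hb.2⟩) ?_
      · rintro ⟨t₁, v₁⟩ ⟨ht₁, hv₁⟩ ⟨t₂, v₂⟩ ⟨ht₂, hv₂⟩ a b ha hb hab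
        have hgr : ∀ t ∈ Φ' z, ∀ v ∈ Ψ' z t, ((z.1, t), v) ∈ Θ.graphG := fun t ht v hv =>
          ⟨⟨hz.1, hΦW z hz ht⟩, hΨY' z hz t (hΦW z hz ht) hv, hv⟩
        have h := (hmap.G_convex (hgr t₁ ht₁ v₁ hv₁) (hgr t₂ ht₂ v₂ hv₂) ha hb hab).2.2
        refine ⟨hmap.unc_convex _ hz.1 ht₁ ht₂ ha hb hab, ?_⟩
        have e2 : a • z.1 + b • z.1 = z.1 := by rw [← add_smul, hab, one_smul]
        simpa [Ψ', e2] using h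
      · have h := ((hg z.1 hz.1).comp_linearMap
          (LinearEquiv.prodComm ℝ (Eucl q) (Eucl p)).toLinearMap).quasiconcaveOn
        have e : (LinearEquiv.prodComm ℝ (Eucl q) (Eucl p)).toLinearMap ⁻¹' (Θ.Y ×ˢ Θ.W) =
            Θ.W ×ˢ Θ.Y := by
          ext r; simp [and_comm]
        rw [e] at h
        exact h
    intro z₁ hz₁ z₂ hz₂ a b ha hb hab
    exact ⟨fun i => h1 i (hz₁.1 i) (hz₂.1 i) ha hb hab, h2 hz₁.2 hz₂.2 ha hb hab⟩
  obtain ⟨⟨x, w⟩, hxw, hx, hw⟩ := exists_fixedPoint_of_isCompact_graph (hXne.prod hW.1) hK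
    (hXconv.prod hW.2.2) hgraph hBRne hBRK hBRconv
  choose hfeas y hy hopt using hx
  obtain ⟨hunc, yw, hyw, hmin⟩ := hw
  refine ⟨x, w, y, yw, ⟨hxw.1, hxw.2, hfeas, hunc, fun i => ?_, fun i u hu v hv => ?_⟩, hyw,
    fun t ht v hv => neg_le_neg_iff.1 (hmin t ht v hv)⟩
  · simpa [Ψ] using hy i
  · simpa [F] using hopt i u hu v hv

end NSNGame

theorem theorem1 {n : ℕ} {d : Fin n → ℕ} {p q : ℕ} (Θ : NSNGame n d p q)
    (hX : ∀ i, (Θ.X i).Nonempty ∧ IsCompact (Θ.X i) ∧ Convex ℝ (Θ.X i))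
    (hY : Θ.Y.Nonempty ∧ IsCompact Θ.Y ∧ Convex ℝ Θ.Y)
    (hW : Θ.W.Nonempty ∧ IsCompact Θ.W ∧ Convex ℝ Θ.W) :
    (Θ.MapAssumption → (∃ S : Set (Fin n), Θ.PayoffAssumption S) →
      ∃ (x : Profile d) (w : Eucl q) (y : Fin n → Eucl p) (yw : Eucl p),
        Θ.IsWeakEquilibrium x w y yw) ∧
    (Θ.MapAssumption → Θ.PayoffAssumption Set.univ →
      ∃ (x : Profile d) (w : Eucl q) (y : Fin n → Eucl p) (yw : Eucl p),
        Θ.IsStrongEquilibrium x w y yw) := by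
  constructor
  · rintro hmap ⟨S, hS⟩
    obtain ⟨i, hi⟩ := hS.nonempty
    -- a minimizer of a single payoff is weakly Pareto optimal
    obtain ⟨x, w, y, yw, hlead, hyw, hmin⟩ := Θ.exists_leaderConditions_minimizing hX hY.2.1 hW hmap
      hS.quasiconcave hS.continuous (hS.neg_concave i hi) (hS.continuous i)
    refine ⟨x, w, y, yw, hlead, hyw, fun t ht v hv hmem => ?_⟩
    rw [← Set.pi_univ_Ici, interior_pi_set Set.finite_univ] at hmem
    have h : _ ∈ interior (Set.Ici (0 : ℝ)) := hmem i (Set.mem_univ i)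
    rw [interior_Ici] at h
    exact absurd (hmin t ht v hv) (not_le.2 (sub_pos.1 h))
  · intro hmap hS
    -- a minimizer of the sum of all payoffs is Pareto optimal
    obtain ⟨x, w, y, yw, hlead, hyw, hmin⟩ := Θ.exists_leaderConditions_minimizing hX hY.2.1 hW hmap
      hS.quasiconcave hS.continuous (g := fun x y w => ∑ i, Θ.f i x y w)
      (fun x hx => by
        have hc : ∀ s : Finset (Fin n), ConcaveOn ℝ (Θ.Y ×ˢ Θ.W)
            (fun z : Eucl p × Eucl q => - ∑ i ∈ s, Θ.f i x z.1 z.2) := fun s => by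
          induction s using Finset.induction_on with
          | empty => simpa using concaveOn_const (0 : ℝ) (hY.2.2.prod hW.2.2)
          | insert i s hi ih =>
            simp only [Finset.sum_insert hi, neg_add]
            exact (hS.neg_concave i (Set.mem_univ i) x hx).add ih
        exact hc Finset.univ)
      (continuousOn_finsetSum _ fun i _ => hS.continuous i)
    refine ⟨x, w, y, yw, hlead, hyw, fun t ht v hv hmem => ?_⟩
    have hlt : 0 < ∑ i, (Θ.payoff x yw w - Θ.payoff x v t) i :=
      Finset.sum_pos' (fun i _ => hmem.1 i) (by
        obtain ⟨i, hi⟩ := Function.ne_iff.1 hmem.2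
        exact ⟨i, Finset.mem_univ i, lt_of_le_of_ne (hmem.1 i) (Ne.symm hi)⟩)
    simp only [Pi.sub_apply, NSNGame.payoff, Finset.sum_sub_distrib] at hlt
    exact absurd (hmin t ht v hv) (not_le.2 (sub_pos.1 hlt))
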